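/- Let $G$ be a finite group. A word in variables $x_1,\dots,x_r$ is a finite sequence of letters $x_i^{\pm1}$; its weight is its length. It is freely trivial if it represents $1$ in the free group, and it is a group law of $G$ if it is not freely trivial but evaluates to $1$ for all $(g_1,\dots,g_r)\in G^r$. Let $\alpha(G)$ be the smallest weight of a group law of $G$. On $\mathbb{C}[G^n]$, with basis $|\mathbf{x}\rangle$, $\mathbf x\in G^n$, consider the $X$-type operators $X^{\mathbf a,\mathbf b}|\mathbf x\rangle=|\mathbf a\mathbf x\mathbf b^{-1}\rangle$ for $\mathbf a,\mathbf b\in G^n$, and the $Z$-type operators $Z^K_w|\mathbf x\rangle=\mathbb{I}(w(\mathbf x)\in K)|\mathbf x\rangle$, where $K\le G$ is a subgroup and $w(\mathbf x)=x_{q_1}^{a_1}\cdots x_{q_j}^{a_j}$ with $q_i\in\{1,\dots,n\}$ (possibly repeated) and $a_i=\pm1$; the weight of $Z_w^K$ is $j$. A group CSS code consists of a set $\mathcal S_X$ of $X$-type operators ($X$-checks) and a set $\mathcal S_Z$ of $Z$-type operators ($Z$-checks) such that every $X$-check preserves the joint $+1$-eigenspace of $\mathcal S_Z$. Its codespace is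 the joint $+1$-eigenspace of $\mathcal S_X\cup\mathcal S_Z$, and its $X$-check group $H\le G^n\times G^n$ is the subgroup generated by the labels $(\mathbf a,\mathbf b)$ of the $X$-checks. Its stabilizers are the operators $X^{\mathbf a,\mathbf b}$ with $(\mathbf a,\mathbf b)\in H$ and the $Z$-type operators which act as the identity on the joint $+1$-eigenspace of $\mathcal S_Z$. The code is $G$-covariant if, for every $g\in G$, conjugation by $X^g_{\mathrm{tot}}:|x_1,\dots,x_n\rangle\mapsto|gx_1g^{-1},\dots,gx_ng^{-1}\rangle$ maps the set of stabilizers onto itself; this holds in particular if it maps $\mathcal S_X\cup\mathcal S_Z$ onto itself. One writes $w_Z\le m$ if every $Z$-check has weight at most $m$, and $d_Z>m$ if for every $Z$-type operator $O$ whose word involves at most $m$ distinct qudits there is $c\in\mathbb C$ with $\langle\psi|O|\varphi\rangle=c\langle\psi|\varphi\rangle$ for all $\psi,\varphi$ in the codespace. Let $\Sigma$ be a finite 2D CW complex given by a finite set $V$ of $0$-cells, oriented $1$-cells $1,\dots,n$ (loops and multiple edges allowed), and finitely many $2$-cells, each glued along a non-empty closed edge path. Let $Y\subseteq V$ be a set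 of ghost vertices. The quantum double code on $(\Sigma,Y)$ has the $X$-checks $X_v^g$ for all $v\in V\setminus Y$ and $g\in G$, where $X_v^g$ multiplies each edge leaving $v$ by $g$ on the left and each edge entering $v$ by $g^{-1}$ on the right, and, for each $2$-cell with boundary path $q_1^{a_1}\cdots q_j^{a_j}$, the $Z$-check $\mathbb I(x_{q_1}^{a_1}\cdots x_{q_j}^{a_j}=1)$. It is called rough if $Y\neq\emptyset$. **Theorem.** Let $G$ be a non-Abelian finite simple group and put $\beta=\lfloor(\alpha(G)-1)/2\rfloor$. Let $\mathcal C$ be a $G$-covariant group CSS code on $n$ $G$-qudits with $d_Z>\beta$ and $w_Z\le\beta$. Then, after a change of generating sets for the checks, $\mathcal C$ is a (possibly rough) quantum double code on a 2D CW complex: there are a complex $\Sigma$ with $1$-cells $1,\dots,n$ and a set $Y$ of ghost vertices such that the quantum double code on $(\Sigma,Y)$ has the same $X$-check group as $\mathcal C$, its $Z$-checks have the same joint $+1$-eigenspace as those of $\mathcal C$, and it has the same codespace as $\mathcal C$. -/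

import Mathlib

/-! ### Words, group laws -/

/-- The value in `G` of the word `w` (letters `(i, true)` for `gᵢ` and `(i, false)` for `gᵢ⁻¹`)
at the assignment `g`. -/
def wordEval {ι G : Type*} [Group G] (g : ι → G) (w : List (ι × Bool)) : G :=
  FreeGroup.lift g (FreeGroup.mk w)

/-- A word is freely trivial if it represents `1` in the free group. -/
def IsFreelyTrivial {ι : Type*} (w : List (ι × Bool)) : Prop :=
  FreeGroup.mk w = 1

/-- A (non-trivial) group law of `G`: a word which is not freely trivial
but evaluates to `1` on all inputs from `G`. -/
def IsGroupLaw (G : Type*) [Group G] {r : ℕ} (w : List (Fin r × Bool)) : Prop :=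
  ¬ IsFreelyTrivial w ∧ ∀ g : Fin r → G, wordEval g w = 1

/-- The smallest law weight `α(G)`: the smallest length of a group law of `G`. -/
noncomputable def smallestLawWeight (G : Type*) [Group G] : ℕ :=
  sInf {m : ℕ | ∃ (r : ℕ) (w : List (Fin r × Bool)), IsGroupLaw G w ∧ w.length = m}

/-! ### Physical space and checks -/

/-- The physical Hilbert space `ℂ[Gⁿ]`. -/
abbrev PhysSpace (n : ℕ) (G : Type*) : Type _ := EuclideanSpace ℂ (Fin n → G)

/-- Label of a `Z`-type operator: a word in the qudits (with orientations) and a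
local subgroup. -/
structure ZCheck (n : ℕ) (G : Type*) [Group G] where
  word : List (Fin n × Bool)
  K : Subgroup G

/-- The weight of a `Z`-check: the number of its qudits, counted with multiplicity. -/
def ZCheck.weight {n : ℕ} {G : Type*} [Group G] (s : ZCheck n G) : ℕ := s.word.length

/-- The set of (distinct) qudits which a `Z`-type operator acts on. -/
def ZCheck.support {n : ℕ} {G : Type*} [Group G] (s : ZCheck n G) : Finset (Fin n) :=
  (s.word.map Prod.fst).toFinset

open Classical in
/-- `Z^K_w |x⟩ = 𝕀(w(x) ∈ K) |x⟩`. -/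
noncomputable def zOp {n : ℕ} {G : Type*} [Group G] (s : ZCheck n G) :
    Module.End ℂ (PhysSpace n G) where
  toFun ψ := WithLp.toLp 2 fun x => if wordEval x s.word ∈ s.K then ψ x else 0
  map_add' ψ φ := by ext x; by_cases h : wordEval x s.word ∈ s.K <;> simp [h]
  map_smul' c ψ := by ext x; by_cases h : wordEval x s.word ∈ s.K <;> simp [h]

/-- Label `(a, b) ∈ Gⁿ × Gⁿ` of an `X`-type operator (left and right multipliers). -/
abbrev XLabel (n : ℕ) (G : Type*) : Type _ := (Fin n → G) × (Fin n → G)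

/-- `X^{a,b} |x⟩ = |a x b⁻¹⟩`, that is `(X^{a,b} ψ)(x) = ψ(a⁻¹ x b)`. -/
def xOp {n : ℕ} {G : Type*} [Group G] (s : XLabel n G) :
    Module.End ℂ (PhysSpace n G) where
  toFun ψ := WithLp.toLp 2 fun x => ψ (s.1⁻¹ * x * s.2)
  map_add' ψ φ := by ext x; simp
  map_smul' c ψ := by ext x; simp

/-- The joint `+1`-eigenspace of a set of operators. -/
def fixedSpace {n : ℕ} {G : Type*} (S : Set (Module.End ℂ (PhysSpace n G))) :
    Submodule ℂ (PhysSpace n G) where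
  carrier := {ψ | ∀ T ∈ S, T ψ = ψ}
  add_mem' h h' T hT := by rw [map_add, h T hT, h' T hT]
  zero_mem' T _ := map_zero T
  smul_mem' c ψ h T hT := by rw [map_smul, h T hT]

/-! ### Group CSS codes -/

/-- A group CSS code on `n` `G`-qudits: a set of `X`-checks and a set of `Z`-checks such that
every `X`-check preserves the joint `+1`-eigenspace of the `Z`-checks. -/
structure GroupCSSCode (n : ℕ) (G : Type*) [Group G] where
  xChecks : Set (XLabel n G)
  zChecks : Set (ZCheck n G)
  preserves : ∀ s ∈ xChecks, ∀ ψ ∈ fixedSpace (zOp '' zChecks), xOp s ψ ∈ fixedSpace (zOp '' zChecks)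

namespace GroupCSSCode

/-- The joint `+1`-eigenspace of the `Z`-checks. -/
noncomputable def zSpace {n : ℕ} {G : Type*} [Group G] (C : GroupCSSCode n G) :
    Submodule ℂ (PhysSpace n G) :=
  fixedSpace (zOp '' C.zChecks)

/-- The set `𝒮 = 𝒮_X ∪ 𝒮_Z` of check operators. -/
def checks {n : ℕ} {G : Type*} [Group G] (C : GroupCSSCode n G) :
    Set (Module.End ℂ (PhysSpace n G)) :=
  xOp '' C.xChecks ∪ zOp '' C.zChecks

/-- The codespace: the joint `+1`-eigenspace of all checks. -/
noncomputable def codespace {n : ℕ} {G : Type*} [Group G] (C : GroupCSSCode n G) :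
    Submodule ℂ (PhysSpace n G) :=
  fixedSpace C.checks

/-- The `X`-check group `H ≤ Gⁿ × Gⁿ` generated by the `X`-checks. -/
def xGroup {n : ℕ} {G : Type*} [Group G] (C : GroupCSSCode n G) : Subgroup (XLabel n G) :=
  Subgroup.closure C.xChecks

/-- The stabilizers generated by the checks: all `X`-type operators in the `X`-check group, and all
`Z`-type operators which act as `1` on the joint `+1`-eigenspace of the `Z`-checks. -/
def stabilizers {n : ℕ} {G : Type*} [Group G] (C : GroupCSSCode n G) :
    Set (Module.End ℂ (PhysSpace n G)) :=
  xOp '' (C.xGroup : Set (XLabel n G)) ∪ {T | ∃ s : ZCheck n G, T = zOp s ∧ ∀ ψ ∈ C.zSpace, T ψ = ψ}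

end GroupCSSCode

/-- `X_tot^g`: simultaneous conjugation `|x₁, …, xₙ⟩ ↦ |g x₁ g⁻¹, …, g xₙ g⁻¹⟩`. -/
def xTot {n : ℕ} {G : Type*} [Group G] (g : G) : Module.End ℂ (PhysSpace n G) :=
  xOp (fun _ => g, fun _ => g)

namespace GroupCSSCode

/-- `G`-covariance: `X_tot^g 𝒮 (X_tot^g)⁻¹ = 𝒮` for all `g`, where `𝒮` is the set of stabilizers.
By `isCovariant_of_checks` below it is enough that conjugation by every `X_tot^g` maps the set of
checks itself onto itself. -/
def IsCovariant {n : ℕ} {G : Type*} [Group G] (C : GroupCSSCode n G) : Prop :=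
  ∀ g : G, (fun T => xTot g * T * xTot g⁻¹) '' C.stabilizers = C.stabilizers

/-- `d_Z > m` (Knill-Laflamme): every `Z`-type operator `O` on at most `m` qudits satisfies
`⟨ψ|O|φ⟩ = c ⟨ψ|φ⟩` on the codespace, with `c` depending only on `O`. -/
def ZDistanceGT {n : ℕ} {G : Type*} [Group G] [Fintype G] (C : GroupCSSCode n G) (m : ℕ) : Prop :=
  ∀ s : ZCheck n G, s.support.card ≤ m →
    ∃ c : ℂ, ∀ ψ ∈ C.codespace, ∀ φ ∈ C.codespace, inner ℂ ψ (zOp s φ) = c * inner ℂ ψ φ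

/-- `w_Z ≤ m`: every `Z`-check has weight at most `m`. -/
def ZWeightLE {n : ℕ} {G : Type*} [Group G] (C : GroupCSSCode n G) (m : ℕ) : Prop :=
  ∀ s ∈ C.zChecks, s.weight ≤ m

end GroupCSSCode

/-! ### Conjugation by `X_tot` -/

theorem xOp_mul {n : ℕ} {G : Type*} [Group G] (s t : XLabel n G) :
    xOp s * xOp t = xOp (s * t) := by
  ext ψ x
  simp [xOp, mul_assoc]

theorem xOp_one {n : ℕ} {G : Type*} [Group G] : xOp (1 : XLabel n G) = 1 := by
  ext ψ x
  simp [xOp]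

theorem xTot_mul_inv {n : ℕ} {G : Type*} [Group G] (g : G) :
    xTot g * xTot g⁻¹ = (1 : Module.End ℂ (PhysSpace n G)) := by
  rw [xTot, xTot, xOp_mul, ← xOp_one]
  congr 1
  ext <;> simp

theorem xTot_inv_mul {n : ℕ} {G : Type*} [Group G] (g : G) :
    xTot g⁻¹ * xTot g = (1 : Module.End ℂ (PhysSpace n G)) := by
  simpa using xTot_mul_inv (n := n) g⁻¹

theorem xTot_conj_xOp {n : ℕ} {G : Type*} [Group G] (g : G) (s : XLabel n G) :
    xTot g * xOp s * xTot g⁻¹ = xOp ((fun _ => g, fun _ => g) * s * (fun _ => g, fun _ => g)⁻¹) := by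
  rw [xTot, xTot, xOp_mul, xOp_mul]
  rfl

theorem wordEval_conj {n : ℕ} {G : Type*} [Group G] (g : G) (x : Fin n → G)
    (w : List (Fin n × Bool)) :
    wordEval (fun i => g * x i * g⁻¹) w = g * wordEval x w * g⁻¹ := by
  have : FreeGroup.lift (fun i => g * x i * g⁻¹)
      = (MulAut.conj g).toMonoidHom.comp (FreeGroup.lift x) := by
    ext i; simp
  simp [wordEval, this]

theorem xTot_conj_zOp {n : ℕ} {G : Type*} [Group G] (g : G) (s : ZCheck n G) :
    xTot g * zOp s * xTot g⁻¹ = zOp ⟨s.word, s.K.map (MulAut.conj g).toMonoidHom⟩ := by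
  ext ψ x
  have hx : ((fun _ => g : Fin n → G)⁻¹ * x * fun _ => g) = fun i => g⁻¹ * x i * g⁻¹⁻¹ := by
    ext i; simp
  have hy : ((fun _ => g⁻¹ : Fin n → G)⁻¹ * ((fun _ => g : Fin n → G)⁻¹ * x * fun _ => g)
      * fun _ => g⁻¹) = x := by
    ext i; simp [mul_assoc]
  have hmem : (g⁻¹ * wordEval x s.word * g⁻¹⁻¹ ∈ s.K) ↔
      wordEval x s.word ∈ s.K.map (MulAut.conj g).toMonoidHom := by
    constructor
    · intro h
      exact ⟨_, h, by simp [mul_assoc]⟩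
    · rintro ⟨k, hk, h⟩
      rw [← h]
      simpa [mul_assoc] using hk
  simp only [Module.End.mul_apply, xTot, xOp, zOp, LinearMap.coe_mk, AddHom.coe_mk]
  rw [hy, hx, wordEval_conj]
  by_cases h : wordEval x s.word ∈ s.K.map (MulAut.conj g).toMonoidHom
  · rw [if_pos (hmem.2 h), if_pos h]
  · rw [if_neg (fun h' => h (hmem.1 h')), if_neg h]

/-- An operator which is both `X`-type and `Z`-type is the identity. -/
theorem eq_one_of_xOp_eq_zOp {n : ℕ} {G : Type*} [Group G] (s : XLabel n G) (t : ZCheck n G)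
    (h : xOp s = zOp t) : xOp s = 1 := by
  have hz : zOp t * zOp t = zOp t := by
    ext ψ x
    by_cases hx : wordEval x t.word ∈ t.K <;> simp [zOp, hx]
  have h1 : xOp s⁻¹ * xOp s = 1 := by rw [xOp_mul, inv_mul_cancel, xOp_one]
  calc xOp s = xOp s⁻¹ * xOp s * xOp s := by rw [h1, one_mul]
    _ = 1 := by rw [mul_assoc, h, hz, ← h, h1]

/-- If conjugation by every `X_tot^g` maps the set of check operators onto itself, then the code is
covariant. -/
theorem GroupCSSCode.isCovariant_of_checks {n : ℕ} {G : Type*} [Group G] (C : GroupCSSCode n G)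
    (h : ∀ g : G, (fun T => xTot g * T * xTot g⁻¹) '' C.checks = C.checks) : C.IsCovariant := by
  have hx : ∀ g : G, ∀ s ∈ C.xGroup, xTot g * xOp s * xTot g⁻¹ ∈ xOp '' (C.xGroup : Set _) := by
    intro g s hs
    induction hs using Subgroup.closure_induction with
    | mem s hs =>
      have hm : xTot g * xOp s * xTot g⁻¹ ∈ C.checks := by
        rw [← h g]; exact ⟨_, Or.inl ⟨s, hs, rfl⟩, rfl⟩
      rcases hm with ⟨t, ht, e⟩ | ⟨t, ht, e⟩
      · exact ⟨t, Subgroup.subset_closure ht, e⟩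
      · refine ⟨1, one_mem _, ?_⟩
        rw [xTot_conj_xOp] at e ⊢
        rw [eq_one_of_xOp_eq_zOp _ t e.symm, xOp_one]
    | one => exact ⟨1, one_mem _, by rw [xOp_one, mul_one, xTot_mul_inv]⟩
    | mul s t _ _ ihs iht =>
      obtain ⟨s', hs', es⟩ := ihs
      obtain ⟨t', ht', et⟩ := iht
      refine ⟨s' * t', mul_mem hs' ht', ?_⟩
      rw [← xOp_mul, es, et, ← xOp_mul]
      have := xTot_inv_mul (n := n) g
      calc xTot g * xOp s * xTot g⁻¹ * (xTot g * xOp t * xTot g⁻¹)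
          = xTot g * xOp s * (xTot g⁻¹ * xTot g) * xOp t * xTot g⁻¹ := by simp only [mul_assoc]
        _ = xTot g * (xOp s * xOp t) * xTot g⁻¹ := by rw [this]; simp only [mul_assoc, one_mul]
    | inv s _ ih =>
      obtain ⟨s', hs', es⟩ := ih
      refine ⟨s'⁻¹, inv_mem hs', ?_⟩
      have e1 : xOp s'⁻¹ * xOp s' = 1 := by rw [xOp_mul, inv_mul_cancel, xOp_one]
      have e2 : xOp s * xOp s⁻¹ = 1 := by rw [xOp_mul, mul_inv_cancel, xOp_one]
      have e3 : xOp s' * (xTot g * xOp s⁻¹ * xTot g⁻¹) = 1 := by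
        rw [es]
        calc xTot g * xOp s * xTot g⁻¹ * (xTot g * xOp s⁻¹ * xTot g⁻¹)
            = xTot g * xOp s * (xTot g⁻¹ * xTot g) * xOp s⁻¹ * xTot g⁻¹ := by
              simp only [mul_assoc]
          _ = xTot g * (xOp s * xOp s⁻¹) * xTot g⁻¹ := by
              rw [xTot_inv_mul]; simp only [mul_assoc, one_mul]
          _ = 1 := by rw [e2, mul_one, xTot_mul_inv]
      calc xOp s'⁻¹ = xOp s'⁻¹ * (xOp s' * (xTot g * xOp s⁻¹ * xTot g⁻¹)) := by rw [e3, mul_one]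
        _ = xTot g * xOp s⁻¹ * xTot g⁻¹ := by rw [← mul_assoc, e1, one_mul]
  have hz : ∀ g : G, ∀ ψ ∈ C.zSpace, xTot g ψ ∈ C.zSpace := by
    rintro g ψ hψ _ ⟨t, ht, rfl⟩
    have hm : xTot g⁻¹ * zOp t * xTot g ∈ C.checks := by
      rw [← h g⁻¹]; exact ⟨_, Or.inr ⟨t, ht, rfl⟩, by simp⟩
    have hfix : (xTot g⁻¹ * zOp t * xTot g : Module.End ℂ (PhysSpace n G)) ψ = ψ := by
      rcases hm with ⟨s, hs, e⟩ | hm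
      · have e' := xTot_conj_zOp g⁻¹ t
        rw [inv_inv] at e'
        rw [← e, eq_one_of_xOp_eq_zOp s _ (e.trans e')]
        rfl
      · exact hψ _ hm
    calc zOp t (xTot g ψ) = (xTot g * xTot g⁻¹ : Module.End ℂ (PhysSpace n G)) (zOp t (xTot g ψ)) := by rw [xTot_mul_inv]; rfl
      _ = xTot g ((xTot g⁻¹ * zOp t * xTot g : Module.End ℂ (PhysSpace n G)) ψ) := rfl
      _ = xTot g ψ := by rw [hfix]
  have hsub : ∀ g : G, ∀ T ∈ C.stabilizers, xTot g * T * xTot g⁻¹ ∈ C.stabilizers := by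
    rintro g T (⟨s, hs, rfl⟩ | ⟨s, rfl, hs⟩)
    · exact Or.inl (hx g s hs)
    · refine Or.inr ⟨_, xTot_conj_zOp g s, fun ψ hψ => ?_⟩
      calc (xTot g * zOp s * xTot g⁻¹ : Module.End ℂ (PhysSpace n G)) ψ = xTot g (zOp s (xTot g⁻¹ ψ)) := rfl
        _ = (xTot g * xTot g⁻¹ : Module.End ℂ (PhysSpace n G)) ψ := by rw [hs _ (hz g⁻¹ ψ hψ)]; rfl
        _ = ψ := by rw [xTot_mul_inv]; rfl
  intro g
  apply Set.Subset.antisymm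
  · rintro _ ⟨T, hT, rfl⟩
    exact hsub g T hT
  · intro T hT
    refine ⟨xTot g⁻¹ * T * xTot g, by simpa using hsub g⁻¹ T hT, ?_⟩
    calc xTot g * (xTot g⁻¹ * T * xTot g) * xTot g⁻¹
        = (xTot g * xTot g⁻¹) * T * (xTot g * xTot g⁻¹) := by simp only [mul_assoc]
      _ = T := by rw [xTot_mul_inv, one_mul, mul_one]

/-! ### Quantum doubles on 2D CW complexes -/

/-- The initial vertex of an oriented edge; `(e, false)` is `e` traversed backwards. -/
def letterInit {E V : Type*} (src tgt : E → V) (a : E × Bool) : V :=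
  if a.2 then src a.1 else tgt a.1

/-- The terminal vertex of an oriented edge. -/
def letterTerm {E V : Type*} (src tgt : E → V) (a : E × Bool) : V :=
  if a.2 then tgt a.1 else src a.1

/-- The word `w` is an edge path from `u` to `v`. -/
def IsEdgePath {E V : Type*} (src tgt : E → V) : V → List (E × Bool) → V → Prop
  | u, [], v => u = v
  | u, a :: w, v => letterInit src tgt a = u ∧ IsEdgePath src tgt (letterTerm src tgt a) w v

/-- A finite 2D CW complex with oriented 1-cells `E`: a directed multigraph (loops and parallel edges
allowed) together with 2-cells, each of which is glued along a closed edge path. -/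
structure CWComplex2D (E : Type) where
  V : Type
  F : Type
  finite_V : Finite V
  finite_F : Finite F
  src : E → V
  tgt : E → V
  bdry : F → List (E × Bool)
  bdry_ne_nil : ∀ f, bdry f ≠ []
  bdry_closed : ∀ f, ∃ v, IsEdgePath src tgt v (bdry f) v

open Classical in
/-- The vertex operator `X_v^g`: left multiplication by `g` on all edges which leave `v`, right
multiplication by `g⁻¹` on all edges which enter `v`. -/
noncomputable def CWComplex2D.vertexCheck {n : ℕ} {G : Type*} [Group G]
    (X : CWComplex2D (Fin n)) (v : X.V) (g : G) : XLabel n G :=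
  (fun q => if X.src q = v then g else 1, fun q => if X.tgt q = v then g else 1)

/-- `C` is the quantum double code on the complex `X` with set of ghost vertices `Y`: qudits are
edges, the `X`-checks are all `X_v^g` with `v` not a ghost vertex, and the `Z`-checks enforce
trivial holonomy around each 2-cell. It is smooth if `Y` is empty and rough otherwise. -/
def GroupCSSCode.IsQuantumDouble {n : ℕ} {G : Type*} [Group G] (C : GroupCSSCode n G)
    (X : CWComplex2D (Fin n)) (Y : Set X.V) : Prop :=
  C.xChecks = {s | ∃ v : X.V, v ∉ Y ∧ ∃ g : G, s = X.vertexCheck v g} ∧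
  C.zChecks = {s | ∃ f : X.F, s = ⟨X.bdry f, ⊥⟩}

/-!
The `X`-check group `H` is a subgroup of a power of the simple group `G`, with one coordinate for
each half-edge (each side of each qudit), and covariance says that it is normalised by the diagonal.
By a Goursat-type argument (`mulSingle_mem_of_separating`) such a subgroup is determined by which
coordinates always agree and which are always trivial: two coordinates could otherwise only be
linked by an automorphism of `G` commuting with all inner automorphisms, which is the identity. The
vertices are the classes of half-edges with equal coordinates, the class of trivial coordinates is
the ghost vertex, and `H` is the group of gauge transformations generated by the vertex operators.

Covariance also makes every `Z`-check either vacuous or a condition `w(x) = 1`, since the normal core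
of its local subgroup is trivial or everything. It remains to compare these conditions with the ones
around the 2-cells, which are all closed edge paths of length at most `β`. A closed path is trivial
on the orbit of `1` under `H`, hence, by the Knill-Laflamme condition, on every configuration that
satisfies the `Z`-checks (`GroupCSSCode.ZDistanceGT.wordEval_eq_one`). Conversely a check word `w`
is trivial on the orbit of `1`, where its value is the product of `g u * (g v)⁻¹` over its letters
from `u` to `v`. This is a word of length at most `2 * β < α(G)` in the vertex variables which
vanishes on `G`, so it is freely trivial (`GroupCSSCode.isFreelyTrivial_boundaryWord`); cancelling
it step by step cuts `w` into closed paths inserted into one another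
(`wordEval_eq_one_of_boundary`), so `w` is trivial wherever all short closed paths are.
-/

/-! ### Subgroups of powers of a simple group -/

/-- A non-abelian simple group has trivial center. -/
theorem eq_one_of_forall_commute {G : Type*} [Group G] [IsSimpleGroup G]
    (hG : ∃ a b : G, a * b ≠ b * a) {c : G} (hc : ∀ g : G, g * c = c * g) : c = 1 := by
  rcases Subgroup.Normal.eq_bot_or_eq_top (inferInstance : (Subgroup.center G).Normal) with h | h
  · rw [← Subgroup.mem_bot, ← h]
    exact Subgroup.mem_center_iff.2 hc
  · obtain ⟨a, b, hab⟩ := hG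
    exact absurd (Subgroup.mem_center_iff.1 (h ▸ Subgroup.mem_top b) a) hab

/-- In a power of a simple group, a coordinate of a subgroup normalised by the diagonal is either
trivial or everything. -/
theorem exists_coord_eq_of_ne_one {V G : Type*} [Group G] [IsSimpleGroup G]
    (M : Subgroup (V → G)) (hM : ∀ g : G, ∀ h ∈ M, (fun v => g * h v * g⁻¹) ∈ M)
    {v : V} (hv : ∃ h ∈ M, h v ≠ 1) (g : G) : ∃ h ∈ M, h v = g := by
  have hn : (M.map (Pi.evalMonoidHom (fun _ : V => G) v)).Normal := by
    refine ⟨?_⟩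
    rintro _ ⟨h, hh, rfl⟩ a
    exact ⟨_, hM a h hh, rfl⟩
  obtain ⟨h, hh, hne⟩ := hv
  rcases hn.eq_bot_or_eq_top with e | e
  · exact absurd (Subgroup.mem_bot.1 (e ▸ Subgroup.mem_map_of_mem _ hh)) hne
  · obtain ⟨k, hk, hkv⟩ := (e ▸ Subgroup.mem_top g :
      g ∈ M.map (Pi.evalMonoidHom (fun _ : V => G) v))
    exact ⟨k, hk, hkv⟩

/-- The elements of `M` which are trivial at all coordinates in `S`. -/
def trivialOn {V G : Type*} [Group G] (M : Subgroup (V → G)) (S : Set V) :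
    Subgroup (V → G) where
  carrier := {h | h ∈ M ∧ ∀ w ∈ S, h w = 1}
  mul_mem' := by
    rintro a b ⟨ha, ha'⟩ ⟨hb, hb'⟩
    exact ⟨mul_mem ha hb, fun w hw => by simp [ha' w hw, hb' w hw]⟩
  one_mem' := ⟨one_mem _, fun _ _ => rfl⟩
  inv_mem' := by
    rintro a ⟨ha, ha'⟩
    exact ⟨inv_mem ha, fun w hw => by simp [ha' w hw]⟩

theorem trivialOn_conj {V G : Type*} [Group G] {M : Subgroup (V → G)}
    (hM : ∀ g : G, ∀ h ∈ M, (fun v => g * h v * g⁻¹) ∈ M) (S : Set V) :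
    ∀ g : G, ∀ h ∈ trivialOn M S, (fun v => g * h v * g⁻¹) ∈ trivialOn M S := by
  rintro g h ⟨hh, hS⟩
  exact ⟨hM g h hh, fun w hw => by simp [hS w hw]⟩

/-- Two coordinates of a subgroup normalised by the diagonal which do not always agree are
independent: no automorphism other than the identity commutes with all conjugations, so the
coordinates cannot be linked by a twist. -/
theorem exists_eq_one_and_ne_one {V G : Type*} [Group G] [IsSimpleGroup G]
    (hG : ∃ a b : G, a * b ≠ b * a) (M : Subgroup (V → G))
    (hM : ∀ g : G, ∀ h ∈ M, (fun v => g * h v * g⁻¹) ∈ M)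
    {v w : V} (hv : ∃ h ∈ M, h v ≠ 1) (hvw : ∃ h ∈ M, h v ≠ h w) :
    ∃ h ∈ M, h w = 1 ∧ h v ≠ 1 := by
  obtain ⟨k, hk, hne⟩ := hvw
  have hc : (k v)⁻¹ * k w ≠ 1 := fun e => hne (inv_mul_eq_one.1 e)
  obtain ⟨g, hg⟩ : ∃ g : G, g * ((k v)⁻¹ * k w) ≠ ((k v)⁻¹ * k w) * g := by
    by_contra! h
    exact hc (eq_one_of_forall_commute hG h)
  obtain ⟨h, hh, rfl⟩ := exists_coord_eq_of_ne_one M hM hv g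
  -- Conjugating `h` by the diagonal element of `k w` and by `k` agrees at `w` but not at `v`.
  refine ⟨_, mul_mem (hM (k w) h hh) (inv_mem (mul_mem (mul_mem hk hh) (inv_mem hk))), ?_, ?_⟩
  · simp [mul_assoc]
  · intro e
    apply hg
    simp only [Pi.mul_apply, Pi.inv_apply] at e
    have e' := mul_inv_eq_one.1 e
    calc h v * ((k v)⁻¹ * k w) = (k v)⁻¹ * (k v * h v * (k v)⁻¹) * k w := by group
      _ = (k v)⁻¹ * (k w * h v * (k w)⁻¹) * k w := by rw [e']
      _ = (k v)⁻¹ * k w * h v := by group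

/-- A subgroup of a finite power of a non-abelian simple group which is normalised by the diagonal
and separates coordinates contains the factors at its non-trivial coordinates. -/
theorem mulSingle_mem_of_separating {V G : Type*} [Finite V] [DecidableEq V] [Group G]
    [IsSimpleGroup G] (hG : ∃ a b : G, a * b ≠ b * a) (M : Subgroup (V → G))
    (hM : ∀ g : G, ∀ h ∈ M, (fun v => g * h v * g⁻¹) ∈ M)
    (hsep : ∀ v w : V, v ≠ w → ∃ h ∈ M, h v ≠ h w)
    {v : V} (hv : ∃ h ∈ M, h v ≠ 1) (g : G) : Pi.mulSingle v g ∈ M := by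
  have key : ∀ S : Finset V, v ∉ S → ∃ h ∈ trivialOn M S, h v ≠ 1 := by
    intro S
    induction S using Finset.induction_on with
    | empty =>
      obtain ⟨h, hh, hne⟩ := hv
      exact fun _ => ⟨h, ⟨hh, by simp⟩, hne⟩
    | insert w S _ ih =>
      intro hvS
      rw [Finset.mem_insert, not_or] at hvS
      obtain ⟨a, b, hab⟩ := hG
      obtain ⟨h, ⟨hh, hS⟩, hha⟩ := exists_coord_eq_of_ne_one _ (trivialOn_conj hM S) (ih hvS.2) a
      have hw : ∃ k ∈ trivialOn M {w}, k v ≠ 1 := by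
        obtain ⟨k, hk, hkw, hkv⟩ := exists_eq_one_and_ne_one ⟨a, b, hab⟩ M hM hv (hsep v w hvS.1)
        exact ⟨k, ⟨hk, by simpa using hkw⟩, hkv⟩
      obtain ⟨k, ⟨hk, hkw⟩, hkb⟩ := exists_coord_eq_of_ne_one _ (trivialOn_conj hM {w}) hw b
      -- The commutator is trivial wherever `h` or `k` is.
      refine ⟨h * k * h⁻¹ * k⁻¹,
        ⟨mul_mem (mul_mem (mul_mem hh hk) (inv_mem hh)) (inv_mem hk), ?_⟩, ?_⟩
      · intro u hu
        rw [Finset.coe_insert, Set.mem_insert_iff] at hu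
        rcases hu with rfl | hu
        · simp [hkw u rfl]
        · simp [hS u hu]
      · intro e
        simp only [Pi.mul_apply, Pi.inv_apply, hha, hkb] at e
        apply hab
        rw [mul_inv_eq_one, mul_inv_eq_iff_eq_mul] at e
        exact e
  have := Fintype.ofFinite V
  obtain ⟨h, ⟨hh, hS⟩, hhg⟩ := exists_coord_eq_of_ne_one _ (trivialOn_conj hM _)
    (key (Finset.univ.erase v) (by simp)) g
  convert hh
  ext w
  by_cases hw : w = v
  · subst hw; simp [hhg]
  · rw [Pi.mulSingle_eq_of_ne hw, hS w (by simp [hw])]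

/-! ### Words and edge paths -/

theorem wordEval_nil {ι G : Type*} [Group G] (x : ι → G) : wordEval x [] = 1 := by
  simp [wordEval]

theorem wordEval_cons {ι G : Type*} [Group G] (x : ι → G) (a : ι × Bool) (w : List (ι × Bool)) :
    wordEval x (a :: w) = (if a.2 then x a.1 else (x a.1)⁻¹) * wordEval x w := by
  obtain ⟨i, _ | _⟩ := a <;> simp [wordEval]

theorem wordEval_append {ι G : Type*} [Group G] (x : ι → G) (w w' : List (ι × Bool)) :
    wordEval x (w ++ w') = wordEval x w * wordEval x w' := by
  rw [wordEval, ← FreeGroup.mul_mk, map_mul]; rfl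

theorem IsEdgePath.append {E V : Type*} {src tgt : E → V} {u v t : V} {p q : List (E × Bool)}
    (hp : IsEdgePath src tgt u p v) (hq : IsEdgePath src tgt v q t) :
    IsEdgePath src tgt u (p ++ q) t := by
  induction p generalizing u with
  | nil => cases hp; exact hq
  | cons a p ih => exact ⟨hp.1, ih hp.2⟩

/-- A gauge transformation of the trivial configuration has holonomy `g u * (g v)⁻¹` along every
path from `u` to `v`. -/
theorem IsEdgePath.wordEval_eq {E V G : Type*} [Group G] {src tgt : E → V} {u v : V}
    {p : List (E × Bool)} (hp : IsEdgePath src tgt u p v) (g : V → G) :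
    wordEval (fun e => g (src e) * (g (tgt e))⁻¹) p = g u * (g v)⁻¹ := by
  induction p generalizing u with
  | nil => cases hp; simp [wordEval_nil]
  | cons a p ih =>
    obtain ⟨rfl, h2⟩ := hp
    rw [wordEval_cons, ih h2]
    obtain ⟨e, _ | _⟩ := a <;> simp [letterInit, letterTerm, mul_assoc]

/-- The word in the vertices which records, letter by letter, the initial vertex and the inverse of
the terminal vertex. -/
def boundaryWord {E V : Type*} (src tgt : E → V) (w : List (E × Bool)) : List (V × Bool) :=
  w.flatMap fun a => [(letterInit src tgt a, true), (letterTerm src tgt a, false)]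

theorem length_boundaryWord {E V : Type*} (src tgt : E → V) (w : List (E × Bool)) :
    (boundaryWord src tgt w).length = 2 * w.length := by
  induction w with
  | nil => rfl
  | cons a w ih =>
    rw [boundaryWord, List.flatMap_cons, List.length_append, ← boundaryWord, ih]
    simp; ring

theorem wordEval_boundaryWord {E V G : Type*} [Group G] (src tgt : E → V) (w : List (E × Bool))
    (g : V → G) : wordEval g (boundaryWord src tgt w) =
      wordEval (fun e => g (src e) * (g (tgt e))⁻¹) w := by
  induction w with
  | nil => rfl
  | cons a w ih =>
    rw [boundaryWord, List.flatMap_cons, wordEval_append, ← boundaryWord, ih, wordEval_cons]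
    obtain ⟨e, _ | _⟩ := a <;> simp [letterInit, letterTerm, wordEval_cons, wordEval_nil]

/-- In a non-empty list of pairs `(u, v)` for which `∏ u * v⁻¹` is freely trivial, some pair has
equal entries or some `v` equals the next `u`, since otherwise the product is a reduced word. -/
theorem exists_cancel_of_prod_eq_one {P V : Type*} (a b : P → V) (L : List P) (hL : L ≠ [])
    (h : (L.map fun p => FreeGroup.of (a p) * (FreeGroup.of (b p))⁻¹).prod = 1) :
    (∃ l₁ p l₂, L = l₁ ++ p :: l₂ ∧ a p = b p) ∨
      ∃ l₁ p q l₂, L = l₁ ++ p :: q :: l₂ ∧ b p = a q := by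
  classical
  by_contra! hcon
  obtain ⟨h1, h2⟩ := hcon
  have hred : FreeGroup.IsReduced (L.flatMap fun p => [(a p, true), (b p, false)]) := by
    have h1' : ∀ p ∈ L, a p ≠ b p := by
      intro p hp
      obtain ⟨s, t, e⟩ := List.append_of_mem hp
      exact h1 s p t e
    have h2' : L.IsChain (fun p q => b p ≠ a q) := by
      rw [List.isChain_iff_forall_rel_of_append_cons_cons]
      intro p q s t e
      exact h2 s p q t e
    clear h hL h1 h2
    unfold FreeGroup.IsReduced
    induction L with
    | nil => simp
    | cons p L ih =>
      have hp := h1' p (by simp)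
      cases L with
      | nil => simp [hp]
      | cons q L =>
        have := ih (fun r hr => h1' r (List.mem_cons_of_mem _ hr)) h2'.tail
        have hpq := (List.isChain_cons_cons.1 h2').1
        simp only [List.flatMap_cons, List.cons_append, List.nil_append] at this ⊢
        rw [List.isChain_cons_cons, List.isChain_cons_cons]
        exact ⟨fun e => absurd e hp, fun e => absurd e hpq, this⟩
  have hmk : ∀ L : List P, FreeGroup.mk (L.flatMap fun p => [(a p, true), (b p, false)]) =
      (L.map fun p => FreeGroup.of (a p) * (FreeGroup.of (b p))⁻¹).prod := by
    intro L
    induction L with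
    | nil => rfl
    | cons p L ih =>
      rw [List.flatMap_cons, ← FreeGroup.mul_mk, ih, List.map_cons, List.prod_cons]
      simp [FreeGroup.of, FreeGroup.inv_mk, FreeGroup.invRev]
  have e := hred.reduce_eq
  rw [← FreeGroup.toWord_mk, hmk, h, FreeGroup.toWord_one] at e
  obtain ⟨p, L, rfl⟩ := List.exists_cons_of_ne_nil hL
  simp at e

/-- An edge path together with its end points. -/
structure EdgePath {E V : Type*} (src tgt : E → V) where
  word : List (E × Bool)
  init : V
  term : V
  isEdgePath : IsEdgePath src tgt init word term

/-- If all closed paths of length at most `m` are trivial at `x`, so is every concatenation of paths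
of total length at most `m` for which the product of the boundaries is freely trivial: a closed path
in it can be dropped and two consecutive paths which fit together can be joined. -/
theorem wordEval_flatMap_eq_one {E V G : Type*} [Group G] {src tgt : E → V} {x : E → G} {m : ℕ}
    (hx : ∀ w : List (E × Bool), w.length ≤ m → (∃ v, IsEdgePath src tgt v w v) →
      wordEval x w = 1)
    (L : List (EdgePath src tgt)) (hm : (L.flatMap EdgePath.word).length ≤ m)
    (h : (L.map fun p => FreeGroup.of p.init * (FreeGroup.of p.term)⁻¹).prod = 1) :
    wordEval x (L.flatMap EdgePath.word) = 1 := by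
  induction hk : L.length using Nat.strong_induction_on generalizing L with
  | _ k ih =>
  subst hk
  by_cases hL : L = []
  · subst hL; exact wordEval_nil x
  rcases exists_cancel_of_prod_eq_one EdgePath.init EdgePath.term L hL h with
    ⟨s, p, t, rfl, e⟩ | ⟨s, p, q, t, rfl, e⟩
  · simp only [List.flatMap_append, List.flatMap_cons, List.length_append] at hm
    have hp : wordEval x p.word = 1 := hx _ (by omega) ⟨p.init, by
      have := p.isEdgePath
      rwa [← e] at this⟩
    have := ih (s ++ t).length (by simp) (s ++ t)
      (by simp only [List.flatMap_append, List.length_append]; omega)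
      (by simpa [e] using h) rfl
    simpa [wordEval_append, hp] using this
  · have := ih (s ++ ⟨p.word ++ q.word, p.init, q.term,
        p.isEdgePath.append (e ▸ q.isEdgePath)⟩ :: t).length (by simp) _
      (by simpa [List.flatMap_append, List.flatMap_cons] using hm)
      (by simpa [e, mul_assoc] using h) rfl
    simpa [wordEval_append, mul_assoc] using this

/-- A word with freely trivial boundary is trivial wherever all closed paths of at most its length
are. -/
theorem wordEval_eq_one_of_boundary {E V G : Type*} [Group G] {src tgt : E → V} {x : E → G} {m : ℕ}
    (hx : ∀ w : List (E × Bool), w.length ≤ m → (∃ v, IsEdgePath src tgt v w v) →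
      wordEval x w = 1)
    (w : List (E × Bool)) (hw : w.length ≤ m)
    (h : IsFreelyTrivial (boundaryWord src tgt w)) : wordEval x w = 1 := by
  let f : E × Bool → EdgePath src tgt := fun a =>
    ⟨[a], letterInit src tgt a, letterTerm src tgt a, rfl, rfl⟩
  have hf : ∀ w : List (E × Bool), (w.map f).flatMap EdgePath.word = w := by
    intro w
    induction w with
    | nil => rfl
    | cons a w ih => rw [List.map_cons, List.flatMap_cons, ih]; rfl
  have hb : ∀ w : List (E × Bool), FreeGroup.mk (boundaryWord src tgt w) =
      ((w.map f).map fun p => FreeGroup.of p.init * (FreeGroup.of p.term)⁻¹).prod := by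
    intro w
    induction w with
    | nil => rfl
    | cons a w ih =>
      rw [boundaryWord, List.flatMap_cons, ← FreeGroup.mul_mk, ← boundaryWord, ih]
      simp [FreeGroup.of, FreeGroup.inv_mk, FreeGroup.invRev, f]
  have := wordEval_flatMap_eq_one hx (w.map f) (by rwa [hf]) (by rw [← hb]; exact h)
  rwa [hf] at this

/-- Words shorter than `α(G)` over any finite alphabet which vanish on `G` are freely trivial. -/
theorem isFreelyTrivial_of_length_lt {V G : Type*} [Finite V] [Group G] (w : List (V × Bool))
    (hlen : w.length < smallestLawWeight G) (hw : ∀ g : V → G, wordEval g w = 1) :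
    IsFreelyTrivial w := by
  obtain ⟨r, ⟨e⟩⟩ := Finite.exists_equiv_fin V
  by_contra hne
  have hmap : FreeGroup.mk (w.map fun a => (e a.1, a.2)) = FreeGroup.map e (FreeGroup.mk w) :=
    (FreeGroup.map.mk).symm
  refine Nat.notMem_of_lt_sInf hlen ⟨r, w.map fun a => (e a.1, a.2), ⟨?_, ?_⟩, by simp⟩
  · intro h
    apply hne
    rw [IsFreelyTrivial, hmap] at h
    exact (FreeGroup.freeGroupCongr e).injective (by simpa using h)
  · intro g
    rw [wordEval, hmap]
    have := hw (g ∘ e)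
    rw [wordEval] at this
    rw [← this, FreeGroup.lift_mk, FreeGroup.map.mk, FreeGroup.lift_mk]
    simp [Function.comp_def]

/-! ### The check operators on basis states -/

/-- The configurations which satisfy all `Z`-checks in `Z`. -/
def solutions {n : ℕ} {G : Type*} [Group G] (Z : Set (ZCheck n G)) : Set (Fin n → G) :=
  {x | ∀ s ∈ Z, wordEval x s.word ∈ s.K}

theorem zOp_apply_eq_self_iff {n : ℕ} {G : Type*} [Group G] (s : ZCheck n G)
    (ψ : PhysSpace n G) : zOp s ψ = ψ ↔ ∀ x, ψ x ≠ 0 → wordEval x s.word ∈ s.K := by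
  constructor
  · intro h x hx
    by_contra hs
    apply hx
    rw [← h]
    simp [zOp, hs]
  · intro h
    ext x
    by_cases hs : wordEval x s.word ∈ s.K
    · simp [zOp, hs]
    · have : ψ x = 0 := by
        by_contra hx
        exact hs (h x hx)
      simp [zOp, this]

theorem mem_fixedSpace_zOp_iff {n : ℕ} {G : Type*} [Group G] (Z : Set (ZCheck n G))
    (ψ : PhysSpace n G) :
    ψ ∈ fixedSpace (zOp '' Z) ↔ ∀ x, ψ x ≠ 0 → x ∈ solutions Z := by
  constructor
  · intro h x hx s hs
    exact (zOp_apply_eq_self_iff s ψ).1 (h _ ⟨s, hs, rfl⟩) x hx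
  · rintro h _ ⟨s, hs, rfl⟩
    exact (zOp_apply_eq_self_iff s ψ).2 fun x hx => h x hx s hs

open Classical in
/-- The indicator function of a set of configurations, as a state. -/
noncomputable def indicatorState {n : ℕ} {G : Type*} (S : Set (Fin n → G)) : PhysSpace n G :=
  WithLp.toLp 2 fun x => if x ∈ S then 1 else 0

theorem indicatorState_ne_zero_iff {n : ℕ} {G : Type*} (S : Set (Fin n → G)) (x : Fin n → G) :
    indicatorState S x ≠ 0 ↔ x ∈ S := by
  simp [indicatorState]

theorem eq_one_of_xOp_eq_one {n : ℕ} {G : Type*} [Group G] [IsSimpleGroup G]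
    (hG : ∃ a b : G, a * b ≠ b * a) {s : XLabel n G} (h : xOp s = 1) : s = 1 := by
  have key : ∀ x : Fin n → G, s.1⁻¹ * x * s.2 = x := by
    intro x
    have h1 : xOp s (indicatorState {x}) x = indicatorState {x} x := by rw [h]; rfl
    by_contra hne
    simp [xOp, indicatorState, hne] at h1
  have h12 : s.1 = s.2 := by
    have := key 1
    rw [mul_one, inv_mul_eq_one] at this
    exact this
  have h1 : s.1 = 1 := by
    funext q
    refine eq_one_of_forall_commute hG fun g => ?_
    have := congrFun (key fun _ => g) q
    rw [← h12] at this
    simp only [Pi.mul_apply, Pi.inv_apply, mul_assoc] at this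
    rw [inv_mul_eq_iff_eq_mul] at this
    exact this
  exact Prod.ext h1 (h12 ▸ h1)

/-! ### The stabilizers of a covariant code -/

namespace GroupCSSCode

theorem mem_zSpace_iff {n : ℕ} {G : Type*} [Group G] (C : GroupCSSCode n G)
    (ψ : PhysSpace n G) : ψ ∈ C.zSpace ↔ ∀ x, ψ x ≠ 0 → x ∈ solutions C.zChecks :=
  mem_fixedSpace_zOp_iff _ _

theorem one_mem_solutions {n : ℕ} {G : Type*} [Group G] (C : GroupCSSCode n G) :
    (1 : Fin n → G) ∈ solutions C.zChecks := by
  intro s _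
  have : wordEval (1 : Fin n → G) s.word = 1 := by
    induction s.word with
    | nil => exact wordEval_nil _
    | cons a w ih => simp [wordEval_cons, ih]
  rw [this]
  exact one_mem _

/-- The `X`-check group acts on the configurations which satisfy the `Z`-checks. -/
theorem xGroup_mul_mem_solutions {n : ℕ} {G : Type*} [Group G] [Finite G] (C : GroupCSSCode n G)
    {s : XLabel n G} (hs : s ∈ C.xGroup) {x : Fin n → G} (hx : x ∈ solutions C.zChecks) :
    s.1 * x * s.2⁻¹ ∈ solutions C.zChecks := by
  -- `G` is finite, so the checks generate their group as a monoid and no inverses are needed.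
  have hs' : s ∈ Submonoid.closure C.xChecks := by
    rw [← Subgroup.closure_toSubmonoid_of_finite]
    exact hs
  clear hs
  induction hs' using Submonoid.closure_induction generalizing x with
  | mem s hs =>
    have h := (mem_fixedSpace_zOp_iff _ _).1 (C.preserves s hs (indicatorState {x})
      ((mem_fixedSpace_zOp_iff _ _).2 fun y hy => by
        rw [indicatorState_ne_zero_iff, Set.mem_singleton_iff] at hy
        rwa [hy]))
    apply h
    have e : s.1⁻¹ * (s.1 * x * s.2⁻¹) * s.2 = x := by group
    change indicatorState {x} (s.1⁻¹ * (s.1 * x * s.2⁻¹) * s.2) ≠ 0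
    rw [e, indicatorState_ne_zero_iff]
    rfl
  | one => simpa using hx
  | mul s t _ _ ihs iht =>
    have := ihs (iht hx)
    simpa [mul_assoc] using this

theorem xOp_apply_eq_of_mem_xGroup {n : ℕ} {G : Type*} [Group G] (C : GroupCSSCode n G)
    {ψ : PhysSpace n G} (h : ∀ s ∈ C.xChecks, xOp s ψ = ψ) {s : XLabel n G} (hs : s ∈ C.xGroup) :
    xOp s ψ = ψ := by
  induction hs using Subgroup.closure_induction with
  | mem s hs => exact h s hs
  | one => rw [xOp_one]; rfl
  | mul s t _ _ ihs iht =>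
    rw [← xOp_mul, Module.End.mul_apply, iht, ihs]
  | inv s _ ih =>
    nth_rw 1 [← ih]
    rw [← Module.End.mul_apply, xOp_mul, inv_mul_cancel, xOp_one]
    rfl

theorem mem_codespace_iff {n : ℕ} {G : Type*} [Group G] (C : GroupCSSCode n G)
    (ψ : PhysSpace n G) :
    ψ ∈ C.codespace ↔ ψ ∈ C.zSpace ∧ ∀ s ∈ C.xGroup, xOp s ψ = ψ := by
  constructor
  · intro h
    exact ⟨fun T hT => h T (Or.inr hT),
      fun s hs => C.xOp_apply_eq_of_mem_xGroup (fun s hs => h _ (Or.inl ⟨s, hs, rfl⟩)) hs⟩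
  · rintro ⟨h1, h2⟩ _ (⟨s, hs, rfl⟩ | hT)
    · exact h2 s (Subgroup.subset_closure hs)
    · exact h1 _ hT

theorem IsCovariant.conj_mem_xGroup {n : ℕ} {G : Type*} [Group G] [IsSimpleGroup G]
    (hG : ∃ a b : G, a * b ≠ b * a) {C : GroupCSSCode n G} (hC : C.IsCovariant) (g : G)
    {s : XLabel n G} (hs : s ∈ C.xGroup) :
    (fun _ => g, fun _ => g) * s * (fun _ => g, fun _ => g)⁻¹ ∈ C.xGroup := by
  have hm : xTot g * xOp s * xTot g⁻¹ ∈ C.stabilizers := by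
    rw [← hC g]
    exact ⟨_, Or.inl ⟨s, hs, rfl⟩, rfl⟩
  rw [xTot_conj_xOp] at hm
  rcases hm with ⟨t, ht, e⟩ | ⟨t, e, -⟩
  · have : xOp (t⁻¹ * ((fun _ => g, fun _ => g) * s * (fun _ => g, fun _ => g)⁻¹)) = 1 := by
      rw [← xOp_mul, ← e, xOp_mul, inv_mul_cancel, xOp_one]
    rw [← inv_mul_eq_one.1 (eq_one_of_xOp_eq_one hG this)]
    exact ht
  · rw [eq_one_of_xOp_eq_one hG (eq_one_of_xOp_eq_zOp _ _ e)]
    exact one_mem _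

/-- By covariance the local subgroup of a `Z`-check can be replaced by its normal core, which is
trivial or everything because `G` is simple. -/
theorem IsCovariant.eq_top_or_wordEval_eq_one {n : ℕ} {G : Type*} [Group G] [IsSimpleGroup G]
    {C : GroupCSSCode n G} (hC : C.IsCovariant) {s : ZCheck n G} (hs : s ∈ C.zChecks) :
    s.K = ⊤ ∨ ∀ x ∈ solutions C.zChecks, wordEval x s.word = 1 := by
  have hcore : ∀ x ∈ solutions C.zChecks, wordEval x s.word ∈ s.K.normalCore := by
    intro x hx g
    have hm : xTot g⁻¹ * zOp s * xTot g⁻¹⁻¹ ∈ C.stabilizers := by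
      rw [← hC g⁻¹]
      exact ⟨_, Or.inr ⟨s, rfl, fun ψ hψ => hψ _ ⟨s, hs, rfl⟩⟩, rfl⟩
    rw [xTot_conj_zOp] at hm
    have hfix : ∀ ψ ∈ C.zSpace,
        zOp ⟨s.word, s.K.map (MulAut.conj g⁻¹).toMonoidHom⟩ ψ = ψ := by
      rcases hm with ⟨t, ht, e⟩ | ⟨t, e, h⟩
      · intro ψ _
        rw [← e, eq_one_of_xOp_eq_zOp _ _ e]
        rfl
      · exact h
    obtain ⟨k, hk, e⟩ := (zOp_apply_eq_self_iff _ _).1 (hfix (indicatorState {x})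
      ((C.mem_zSpace_iff _).2 fun y hy => by
        rw [indicatorState_ne_zero_iff, Set.mem_singleton_iff] at hy
        rwa [hy])) x ((indicatorState_ne_zero_iff _ _).2 rfl)
    rw [← e]
    simpa [mul_assoc] using hk
  rcases (inferInstance : s.K.normalCore.Normal).eq_bot_or_eq_top with h | h
  · right
    intro x hx
    simpa [h] using hcore x hx
  · left
    exact top_unique (h ▸ s.K.normalCore_le)

/-! ### Local words take the same value on all orbits -/

/-- The orbit of a configuration under the `X`-check group. -/
def orbit {n : ℕ} {G : Type*} [Group G] (C : GroupCSSCode n G) (x : Fin n → G) :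
    Set (Fin n → G) :=
  {y | ∃ s ∈ C.xGroup, y = s.1 * x * s.2⁻¹}

theorem self_mem_orbit {n : ℕ} {G : Type*} [Group G] (C : GroupCSSCode n G) (x : Fin n → G) :
    x ∈ C.orbit x :=
  ⟨1, one_mem _, by simp⟩

theorem indicatorState_orbit_mem_codespace {n : ℕ} {G : Type*} [Group G] [Finite G]
    (C : GroupCSSCode n G) {x : Fin n → G} (hx : x ∈ solutions C.zChecks) :
    indicatorState (C.orbit x) ∈ C.codespace := by
  rw [mem_codespace_iff, mem_zSpace_iff]
  constructor
  · intro y hy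
    obtain ⟨s, hs, rfl⟩ := (indicatorState_ne_zero_iff _ _).1 hy
    exact C.xGroup_mul_mem_solutions hs hx
  · intro s hs
    ext y
    have : s.1⁻¹ * y * s.2 ∈ C.orbit x ↔ y ∈ C.orbit x := by
      constructor
      · rintro ⟨t, ht, e⟩
        refine ⟨s * t, mul_mem hs ht, ?_⟩
        calc y = s.1 * (s.1⁻¹ * y * s.2) * s.2⁻¹ := by group
          _ = _ := by rw [e, Prod.fst_mul, Prod.snd_mul]; group
      · rintro ⟨t, ht, rfl⟩
        refine ⟨s⁻¹ * t, mul_mem (inv_mem hs) ht, ?_⟩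
        rw [Prod.fst_mul, Prod.snd_mul, Prod.fst_inv, Prod.snd_inv]
        group
    classical exact if_congr this rfl rfl

open Classical in
theorem inner_indicatorState_zOp {n : ℕ} {G : Type*} [Group G] [Fintype G]
    (S : Set (Fin n → G)) (s : ZCheck n G) :
    inner ℂ (indicatorState S) (zOp s (indicatorState S)) =
      ((Finset.univ.filter fun x => x ∈ S ∧ wordEval x s.word ∈ s.K).card : ℂ) := by
  rw [PiLp.inner_apply, Finset.card_filter, Nat.cast_sum]
  refine Finset.sum_congr rfl fun x _ => ?_
  by_cases h1 : x ∈ S <;> by_cases h2 : wordEval x s.word ∈ s.K <;>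
    simp [indicatorState, zOp, h1, h2]

open Classical in
theorem inner_indicatorState_self {n : ℕ} {G : Type*} [Fintype G] (S : Set (Fin n → G)) :
    inner ℂ (indicatorState S) (indicatorState S) =
      ((Finset.univ.filter fun x => x ∈ S).card : ℂ) := by
  rw [PiLp.inner_apply, Finset.card_filter, Nat.cast_sum]
  refine Finset.sum_congr rfl fun x _ => ?_
  by_cases h1 : x ∈ S <;> simp [indicatorState, h1]

/-- If `d_Z > m`, a word on at most `m` qudits which is trivial on the orbit of `1` is trivial on
all configurations which satisfy the `Z`-checks: the fraction of an orbit on which it is trivial is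
the Knill-Laflamme constant, the same for all orbits. -/
theorem ZDistanceGT.wordEval_eq_one {n : ℕ} {G : Type*} [Group G] [Fintype G]
    {C : GroupCSSCode n G} {m : ℕ} (hC : C.ZDistanceGT m) (w : List (Fin n × Bool))
    (hw : w.length ≤ m) (h1 : ∀ y ∈ C.orbit 1, wordEval y w = 1)
    {x : Fin n → G} (hx : x ∈ solutions C.zChecks) : wordEval x w = 1 := by
  classical
  have hsupp : (ZCheck.support (⟨w, ⊥⟩ : ZCheck n G)).card ≤ m :=
    (List.toFinset_card_le _).trans (by simpa using hw)
  obtain ⟨c, hc⟩ := hC ⟨w, ⊥⟩ hsupp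
  have hc1 : c = 1 := by
    have hψ := C.indicatorState_orbit_mem_codespace C.one_mem_solutions
    have h := hc _ hψ _ hψ
    rw [(zOp_apply_eq_self_iff _ _).2 fun y hy =>
      Subgroup.mem_bot.2 (h1 y ((indicatorState_ne_zero_iff _ _).1 hy))] at h
    refine (mul_right_cancel₀ ?_ (h.symm.trans (one_mul _).symm))
    rw [inner_self_ne_zero]
    intro e
    apply (indicatorState_ne_zero_iff (C.orbit (1 : Fin n → G)) 1).2 (C.self_mem_orbit 1)
    rw [e]
    rfl
  have hψ := C.indicatorState_orbit_mem_codespace hx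
  have h := hc _ hψ _ hψ
  rw [hc1, one_mul, inner_indicatorState_zOp, inner_indicatorState_self, Nat.cast_inj] at h
  have hsub : (Finset.univ.filter fun y => y ∈ C.orbit x ∧ wordEval y w ∈ (⊥ : Subgroup G)) ⊆
      Finset.univ.filter fun y => y ∈ C.orbit x :=
    Finset.monotone_filter_right _ fun _ _ h => h.1
  have heq := Finset.eq_of_subset_of_card_le hsub h.ge
  have hmem : x ∈ Finset.univ.filter fun y => y ∈ C.orbit x := by
    simpa using C.self_mem_orbit x
  rw [← heq, Finset.mem_filter] at hmem
  exact Subgroup.mem_bot.1 hmem.2.2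

/-! ### The complex of a covariant code -/

/-- The component of an `X`-label at a half-edge: `(q, true)` is the initial half of the edge `q`,
which carries the left multiplier, and `(q, false)` its terminal half with the right one. -/
def halfEdgeLabel {n : ℕ} {G : Type*} (s : XLabel n G) (a : Fin n × Bool) : G :=
  if a.2 then s.1 a.1 else s.2 a.1

/-- Half-edges meet at a vertex if they have the same component in every element of the `X`-check
group. -/
def vertexSetoid {n : ℕ} {G : Type*} [Group G] (C : GroupCSSCode n G) : Setoid (Fin n × Bool) where
  r a b := ∀ s ∈ C.xGroup, halfEdgeLabel s a = halfEdgeLabel s b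
  iseqv := ⟨fun _ _ _ => rfl, fun h s hs => (h s hs).symm,
    fun h h' s hs => (h s hs).trans (h' s hs)⟩

/-- The vertices of the complex of a code: the classes of half-edges on which the `X`-check group
acts in the same way. -/
abbrev Vertex {n : ℕ} {G : Type*} [Group G] (C : GroupCSSCode n G) : Type :=
  Quotient C.vertexSetoid

/-- The initial vertex of an edge. -/
def src {n : ℕ} {G : Type*} [Group G] (C : GroupCSSCode n G) (q : Fin n) : C.Vertex :=
  Quotient.mk _ (q, true)

/-- The terminal vertex of an edge. -/
def tgt {n : ℕ} {G : Type*} [Group G] (C : GroupCSSCode n G) (q : Fin n) : C.Vertex :=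
  Quotient.mk _ (q, false)

/-- The ghost vertices: those at which the `X`-check group acts trivially. There is at most one. -/
def ghosts {n : ℕ} {G : Type*} [Group G] (C : GroupCSSCode n G) : Set C.Vertex :=
  {v | ∀ a : Fin n × Bool, Quotient.mk C.vertexSetoid a = v →
    ∀ s ∈ C.xGroup, halfEdgeLabel s a = 1}

/-- The gauge transformation with parameter `g v` at each vertex `v`. -/
def gauge {n : ℕ} {G : Type*} [Group G] (C : GroupCSSCode n G) :
    (C.Vertex → G) →* XLabel n G where
  toFun g := (fun q => g (C.src q), fun q => g (C.tgt q))
  map_one' := rfl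
  map_mul' _ _ := rfl

theorem halfEdgeLabel_gauge {n : ℕ} {G : Type*} [Group G] (C : GroupCSSCode n G)
    (g : C.Vertex → G) (a : Fin n × Bool) :
    halfEdgeLabel (C.gauge g) a = g (Quotient.mk _ a) := by
  obtain ⟨q, _ | _⟩ := a <;> rfl

theorem exists_gauge_eq {n : ℕ} {G : Type*} [Group G] (C : GroupCSSCode n G) {s : XLabel n G}
    (hs : s ∈ C.xGroup) : ∃ g, C.gauge g = s :=
  ⟨Quotient.lift (halfEdgeLabel s) fun _ _ h => h s hs, rfl⟩

theorem ghosts_subsingleton {n : ℕ} {G : Type*} [Group G] (C : GroupCSSCode n G) :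
    C.ghosts.Subsingleton := by
  intro v hv w hw
  induction v using Quotient.inductionOn with | _ a =>
  induction w using Quotient.inductionOn with | _ b =>
  exact Quotient.sound fun s hs => (hv a rfl s hs).trans (hw b rfl s hs).symm

theorem eq_one_of_mem_ghosts {n : ℕ} {G : Type*} [Group G] (C : GroupCSSCode n G)
    {g : C.Vertex → G} (hg : C.gauge g ∈ C.xGroup) {v : C.Vertex} (hv : v ∈ C.ghosts) :
    g v = 1 := by
  induction v using Quotient.inductionOn with | _ a =>
  rw [← C.halfEdgeLabel_gauge g]
  exact hv a rfl _ hg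

theorem mulSingle_gauge_mem {n : ℕ} {G : Type*} [Group G] [IsSimpleGroup G]
    (hG : ∃ a b : G, a * b ≠ b * a) {C : GroupCSSCode n G} (hC : C.IsCovariant)
    [DecidableEq C.Vertex] {v : C.Vertex} (hv : v ∉ C.ghosts) (g : G) :
    C.gauge (Pi.mulSingle v g) ∈ C.xGroup := by
  have hmem : Pi.mulSingle v g ∈ C.xGroup.comap C.gauge := by
    refine mulSingle_mem_of_separating hG _ (fun a h hh => hC.conj_mem_xGroup hG a hh) ?_ ?_ g
    · intro u w huw
      by_contra! hcon
      apply huw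
      induction u using Quotient.inductionOn with | _ a =>
      induction w using Quotient.inductionOn with | _ b =>
      refine Quotient.sound fun s hs => ?_
      obtain ⟨k, rfl⟩ := C.exists_gauge_eq hs
      rw [halfEdgeLabel_gauge, halfEdgeLabel_gauge]
      exact hcon k hs
    · by_contra! hcon
      apply hv
      rintro a rfl s hs
      obtain ⟨k, rfl⟩ := C.exists_gauge_eq hs
      rw [halfEdgeLabel_gauge]
      exact hcon k hs
  exact hmem

/-- The `X`-check group consists of all gauge transformations which are trivial at the ghosts. -/
theorem gauge_mem_xGroup {n : ℕ} {G : Type*} [Group G] [IsSimpleGroup G]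
    (hG : ∃ a b : G, a * b ≠ b * a) {C : GroupCSSCode n G} (hC : C.IsCovariant)
    {g : C.Vertex → G} (hg : ∀ v ∈ C.ghosts, g v = 1) : C.gauge g ∈ C.xGroup := by
  classical
  have : g ∈ C.xGroup.comap C.gauge := by
    refine Subgroup.pi_mem_of_mulSingle_mem g fun v => ?_
    by_cases hv : v ∈ C.ghosts
    · rw [hg v hv, Pi.mulSingle_one]
      exact one_mem _
    · exact mulSingle_gauge_mem hG hC hv _
  exact this

/-- On the orbit of `1` the holonomy around a closed path is trivial. -/
theorem wordEval_eq_one_of_mem_orbit_one {n : ℕ} {G : Type*} [Group G] (C : GroupCSSCode n G)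
    {w : List (Fin n × Bool)} {v : C.Vertex} (hw : IsEdgePath C.src C.tgt v w v) :
    ∀ y ∈ C.orbit 1, wordEval y w = 1 := by
  rintro _ ⟨s, hs, rfl⟩
  obtain ⟨g, rfl⟩ := C.exists_gauge_eq hs
  have := hw.wordEval_eq g
  rw [mul_inv_cancel] at this
  rw [← this, mul_one]
  rfl

/-- A word which is trivial on the orbit of `1` and has at most half the length of a law has freely
trivial boundary: its boundary word is a law in the vertex variables. The variable of the ghost
vertex is normalised to `1` by a global right multiplication, which does not affect the products
`g u * (g v)⁻¹`. -/
theorem isFreelyTrivial_boundaryWord {n : ℕ} {G : Type*} [Group G] [IsSimpleGroup G]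
    (hG : ∃ a b : G, a * b ≠ b * a) {C : GroupCSSCode n G} (hC : C.IsCovariant)
    (w : List (Fin n × Bool)) (hlen : 2 * w.length < smallestLawWeight G)
    (h1 : ∀ y ∈ C.orbit 1, wordEval y w = 1) :
    IsFreelyTrivial (boundaryWord C.src C.tgt w) := by
  refine isFreelyTrivial_of_length_lt (G := G) _ (by rwa [length_boundaryWord]) fun g => ?_
  obtain ⟨c, hc⟩ : ∃ c : G, ∀ v ∈ C.ghosts, g v * c = 1 := by
    rcases C.ghosts_subsingleton.eq_empty_or_singleton with h | ⟨v, h⟩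
    · exact ⟨1, by simp [h]⟩
    · exact ⟨(g v)⁻¹, by simp [h]⟩
  rw [wordEval_boundaryWord]
  have := h1 _ ⟨_, gauge_mem_xGroup hG hC hc, rfl⟩
  convert this using 2
  ext q
  simp [gauge]

/-- The complex of a code: its 2-cells are all non-empty closed paths of length at most `m`. -/
def complex {n : ℕ} {G : Type*} [Group G] (C : GroupCSSCode n G) (m : ℕ) :
    CWComplex2D (Fin n) where
  V := C.Vertex
  F := {w : List (Fin n × Bool) // w.length ≤ m ∧ w ≠ [] ∧ ∃ v, IsEdgePath C.src C.tgt v w v}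
  finite_V := inferInstance
  finite_F := ((List.finite_length_le _ m).subset fun _ h => h.1).to_subtype
  src := C.src
  tgt := C.tgt
  bdry := Subtype.val
  bdry_ne_nil f := f.2.2.1
  bdry_closed f := f.2.2.2

theorem vertexCheck_complex {n : ℕ} {G : Type*} [Group G] (C : GroupCSSCode n G) (m : ℕ)
    [DecidableEq C.Vertex] (v : C.Vertex) (g : G) :
    (C.complex m).vertexCheck v g = C.gauge (Pi.mulSingle v g) := by
  ext q
  · by_cases h : C.src q = v
    · subst h; simp [CWComplex2D.vertexCheck, complex, gauge]
    · simp [CWComplex2D.vertexCheck, complex, gauge, h]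
  · by_cases h : C.tgt q = v
    · subst h; simp [CWComplex2D.vertexCheck, complex, gauge]
    · simp [CWComplex2D.vertexCheck, complex, gauge, h]

/-- The vertex operators at the non-ghost vertices generate the `X`-check group. -/
theorem closure_vertexChecks {n : ℕ} {G : Type*} [Group G] [IsSimpleGroup G]
    (hG : ∃ a b : G, a * b ≠ b * a) {C : GroupCSSCode n G} (hC : C.IsCovariant) (m : ℕ) :
    Subgroup.closure {s | ∃ v : (C.complex m).V, v ∉ C.ghosts ∧
      ∃ g : G, s = (C.complex m).vertexCheck v g} = C.xGroup := by
  classical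
  apply le_antisymm
  · rw [Subgroup.closure_le]
    rintro _ ⟨v, hv, g, rfl⟩
    rw [show (C.complex m).vertexCheck v g = _ from C.vertexCheck_complex m v g]
    exact mulSingle_gauge_mem hG hC hv g
  · intro s hs
    obtain ⟨g, rfl⟩ := C.exists_gauge_eq hs
    have : g ∈ (Subgroup.closure {s | ∃ v : (C.complex m).V, v ∉ C.ghosts ∧
        ∃ g : G, s = (C.complex m).vertexCheck v g}).comap C.gauge := by
      refine Subgroup.pi_mem_of_mulSingle_mem g fun v => ?_
      by_cases hv : v ∈ C.ghosts
      · rw [C.eq_one_of_mem_ghosts hs hv, Pi.mulSingle_one]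
        exact one_mem _
      · exact Subgroup.subset_closure ⟨v, hv, g v, (C.vertexCheck_complex m v _).symm⟩
    exact this

/-- The trivial-holonomy conditions around the 2-cells are equivalent to the `Z`-checks. The case
`m = 0`, in which all check words are empty, needs no bound on the law weight. -/
theorem solutions_complex {n : ℕ} {G : Type*} [Group G] [Fintype G] [IsSimpleGroup G]
    (hG : ∃ a b : G, a * b ≠ b * a) {C : GroupCSSCode n G} (hC : C.IsCovariant) {m : ℕ}
    (hm : m = 0 ∨ 2 * m < smallestLawWeight G) (hdist : C.ZDistanceGT m)
    (hweight : C.ZWeightLE m) :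
    solutions {s : ZCheck n G | ∃ f : (C.complex m).F, s = ⟨(C.complex m).bdry f, ⊥⟩} =
      solutions C.zChecks := by
  ext x
  constructor
  · intro hx s hs
    rcases hC.eq_top_or_wordEval_eq_one hs with h | h
    · rw [h]; exact Subgroup.mem_top _
    have hlen : s.word.length ≤ m := hweight s hs
    have hfree : IsFreelyTrivial (boundaryWord C.src C.tgt s.word) := by
      rcases hm with rfl | hm
      · rw [List.length_eq_zero_iff.1 (Nat.le_zero.1 hlen)]
        rfl
      · refine isFreelyTrivial_boundaryWord hG hC _ (by omega) ?_
        rintro _ ⟨t, ht, rfl⟩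
        exact h _ (C.xGroup_mul_mem_solutions ht C.one_mem_solutions)
    rw [wordEval_eq_one_of_boundary (x := x) (m := m) ?_ s.word hlen hfree]
    · exact one_mem _
    · intro w hw hclosed
      by_cases hnil : w = []
      · rw [hnil, wordEval_nil]
      · exact Subgroup.mem_bot.1 (hx ⟨w, ⊥⟩ ⟨⟨w, hw, hnil, hclosed⟩, rfl⟩)
  · rintro hx _ ⟨⟨w, hw, hnil, v, hv⟩, rfl⟩
    exact Subgroup.mem_bot.2
      (hdist.wordEval_eq_one w hw (C.wordEval_eq_one_of_mem_orbit_one hv) hx)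

end GroupCSSCode

theorem mainTheorem1 {G : Type*} [Group G] [Fintype G] [IsSimpleGroup G]
    (hG : ∃ a b : G, a * b ≠ b * a)
    (β : ℕ) (hβ : β = (smallestLawWeight G - 1) / 2)
    {n : ℕ} (C : GroupCSSCode n G)
    (hcov : C.IsCovariant)
    (hdist : C.ZDistanceGT β)
    (hweight : C.ZWeightLE β) :
    ∃ (C' : GroupCSSCode n G) (X : CWComplex2D (Fin n)) (Y : Set X.V),
      C'.IsQuantumDouble X Y ∧
      C'.xGroup = C.xGroup ∧
      C'.zSpace = C.zSpace ∧
      C'.codespace = C.codespace := by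
  have hsol := GroupCSSCode.solutions_complex hG hcov (m := β) (by omega) hdist hweight
  have hx := GroupCSSCode.closure_vertexChecks hG hcov β
  have hz : fixedSpace (zOp ''
      {s : ZCheck n G | ∃ f : (C.complex β).F, s = ⟨(C.complex β).bdry f, ⊥⟩}) = C.zSpace := by
    ext ψ
    rw [mem_fixedSpace_zOp_iff, hsol, C.mem_zSpace_iff]
  let C' : GroupCSSCode n G :=
    { xChecks := {s | ∃ v : (C.complex β).V, v ∉ C.ghosts ∧
        ∃ g : G, s = (C.complex β).vertexCheck v g}
      zChecks := {s | ∃ f : (C.complex β).F, s = ⟨(C.complex β).bdry f, ⊥⟩}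
      preserves := by
        intro s hs ψ hψ
        rw [hz, C.mem_zSpace_iff] at hψ ⊢
        intro y hy
        have hmem : s ∈ C.xGroup := hx ▸ Subgroup.subset_closure hs
        have e : s.1 * (s.1⁻¹ * y * s.2) * s.2⁻¹ = y := by group
        rw [← e]
        exact C.xGroup_mul_mem_solutions hmem (hψ _ hy) }
  have hx' : C'.xGroup = C.xGroup := hx
  have hz' : C'.zSpace = C.zSpace := hz
  refine ⟨C', C.complex β, C.ghosts, ⟨rfl, rfl⟩, hx', hz', ?_⟩
  ext ψ
  rw [C'.mem_codespace_iff, C.mem_codespace_iff, hx', hz']
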